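/- Let $S(\sigma)=-\mathrm{Tr}(\sigma\log_2\sigma)$ be the von Neumann entropy. For a state $\rho$ of three senders $A_1,A_2,A_3$ and a receiver $B$, and a class $O$ of operations of the senders, define the quantum advantage of dense coding $$\Delta_O(\rho)=S(\rho_B)-\inf_{\Lambda\in O}S\big((\Lambda_{A_1A_2A_3}\otimes \mathrm{id}_B)[\rho]\big),$$ where the infimum is over all operations in $O$, with arbitrary finite output dimensions $d'_{A_1},d'_{A_2},d'_{A_3}$. For $O=G$ all completely positive trace preserving maps on $A_1A_2A_3$ are allowed. For $O=\mathrm{LOCC}$ only local operations and classical communication among $A_1,A_2,A_3$ are allowed: in each of finitely many rounds one sender applies a local quantum instrument with finitely many outcomes, which may depend on all earlier outcomes, and announces the outcome to the others. Let $|\psi_\mu\rangle=(\sigma_\mu\otimes 1)\tfrac{1}{\sqrt2}(|00\rangle+|11\rangle)$, $\mu=0,1,2,3$, be the Bell states, where $\sigma_0=1$ and $\sigma_1,\sigma_2,\sigma_3$ are the Pauli matrices, and let $$\rho_{A_1BA_2A_3}=\frac14\sum_{\mu=0}^{3}|\psi_\mu\rangle\langle\psi_\mu|_{A_1B}\otimes|\psi_\mu\rangle\langle\psi_\mu|_{A_2A_3}$$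 be the Smolin state of four qubits. Then $\Delta_{\mathrm{LOCC}}(\rho)=0$, while $\Delta_{G}(\rho)>0$. Moreover, for every LOCC operation $\Lambda$ of the senders, with any output dimensions, the entropies $S'$ of the output state $\rho'=(\Lambda\otimes\mathrm{id}_B)[\rho]$ and of its reductions satisfy $$S'(A_1BA_2A_3)\ \ge\ S'(A_1B)\ \ge\ S(B),$$ where $S(B)=S(\rho_B)$. -/

import Mathlib

open scoped Kronecker ComplexOrder

noncomputable section

namespace DenseCoding

/-- Square complex matrices with rows and columns indexed by `n`: the operators on `ℂⁿ`. -/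
abbrev Op (n : Type) : Type := Matrix n n ℂ

/-- The basis labels of the joint system of three senders with local dimensions `a₁, a₂, a₃`. -/
abbrev Senders (a₁ a₂ a₃ : ℕ) : Type := Fin a₁ × Fin a₂ × Fin a₃

/-! ### Entropy and reduced states -/

/-- The von Neumann entropy `-Tr (ρ log₂ ρ)`, in bits, computed from the eigenvalues of `ρ`
(with `0 log 0 = 0`); the value on non-Hermitian matrices is irrelevant. -/
def entropy {n : Type} [Fintype n] [DecidableEq n] (ρ : Op n) : ℝ :=
  haveI : Decidable ρ.IsHermitian := Classical.propDecidable _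
  if h : ρ.IsHermitian then (∑ i, Real.negMulLog (h.eigenvalues i)) / Real.log 2 else 0

/-- The partial trace over the first factor. -/
def traceFst {m n : Type} [Fintype m] (ρ : Op (m × n)) : Op n :=
  Matrix.of fun k l => ∑ i, ρ (i, k) (i, l)

/-- The reduced state of the first sender and the receiver. -/
def reduceA₁B {a₁ a₂ a₃ b : ℕ} (ρ : Op (Senders a₁ a₂ a₃ × Fin b)) : Op (Fin a₁ × Fin b) :=
  Matrix.of fun p q => ∑ j, ∑ k, ρ ((p.1, j, k), p.2) ((q.1, j, k), q.2)

/-! ### Quantum operations -/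

/-- The map `Λ ⊗ id` obtained by letting `Λ` act on the first factor of a bipartite system. -/
def onFst {m n : Type} (r : Type) (Λ : Op m →ₗ[ℂ] Op n) : Op (m × r) →ₗ[ℂ] Op (n × r) where
  toFun X := Matrix.of fun p q => Λ (Matrix.of fun s t => X (s, p.2) (t, q.2)) p.1 q.1
  map_add' X Y := by
    ext p q
    exact congrFun (congrFun (Λ.map_add (Matrix.of fun s t => X (s, p.2) (t, q.2))
      (Matrix.of fun s t => Y (s, p.2) (t, q.2))) p.1) q.1
  map_smul' c X := by
    ext p q
    exact congrFun (congrFun (Λ.map_smul c (Matrix.of fun s t => X (s, p.2) (t, q.2))) p.1) q.1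

/-- Complete positivity: `Λ ⊗ id_k` preserves positive semidefiniteness for every `k`. -/
def IsCP {m n : Type} (Λ : Op m →ₗ[ℂ] Op n) : Prop :=
  ∀ (k : ℕ) (X : Op (m × Fin k)), X.PosSemidef → (onFst (Fin k) Λ X).PosSemidef

/-- Completely positive trace preserving (CPTP) maps. -/
structure IsCPTP {m n : Type} [Fintype m] [Fintype n] (Λ : Op m →ₗ[ℂ] Op n) : Prop where
  cp : IsCP Λ
  tp : ∀ X, (Λ X).trace = X.trace

/-- A quantum instrument with finitely many outcomes: a family of completely positive maps whose
sum preserves the trace. The output dimension may depend on the outcome. -/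
structure IsInstrument {n k : ℕ} {d : Fin k → ℕ}
    (E : (x : Fin k) → Op (Fin n) →ₗ[ℂ] Op (Fin (d x))) : Prop where
  cp : ∀ x, IsCP (E x)
  tp : ∀ X, ∑ x, (E x X).trace = X.trace

/-- The map `E ⊗ id ⊗ id` on the senders' system. -/
def local₁ {a₁ a₁' : ℕ} (a₂ a₃ : ℕ) (E : Op (Fin a₁) →ₗ[ℂ] Op (Fin a₁')) :
    Op (Senders a₁ a₂ a₃) →ₗ[ℂ] Op (Senders a₁' a₂ a₃) :=
  onFst (Fin a₂ × Fin a₃) E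

/-- The map `id ⊗ E ⊗ id` on the senders' system. -/
def local₂ {a₂ a₂' : ℕ} (a₁ a₃ : ℕ) (E : Op (Fin a₂) →ₗ[ℂ] Op (Fin a₂')) :
    Op (Senders a₁ a₂ a₃) →ₗ[ℂ] Op (Senders a₁ a₂' a₃) where
  toFun X := Matrix.of fun p q =>
    E (Matrix.of fun s t => X (p.1, s, p.2.2) (q.1, t, q.2.2)) p.2.1 q.2.1
  map_add' X Y := by
    ext p q
    exact congrFun (congrFun (E.map_add
      (Matrix.of fun s t => X (p.1, s, p.2.2) (q.1, t, q.2.2))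
      (Matrix.of fun s t => Y (p.1, s, p.2.2) (q.1, t, q.2.2))) p.2.1) q.2.1
  map_smul' c X := by
    ext p q
    exact congrFun (congrFun (E.map_smul c
      (Matrix.of fun s t => X (p.1, s, p.2.2) (q.1, t, q.2.2))) p.2.1) q.2.1

/-- The map `id ⊗ id ⊗ E` on the senders' system. -/
def local₃ {a₃ a₃' : ℕ} (a₁ a₂ : ℕ) (E : Op (Fin a₃) →ₗ[ℂ] Op (Fin a₃')) :
    Op (Senders a₁ a₂ a₃) →ₗ[ℂ] Op (Senders a₁ a₂ a₃') where
  toFun X := Matrix.of fun p q =>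
    E (Matrix.of fun s t => X (p.1, p.2.1, s) (q.1, q.2.1, t)) p.2.2 q.2.2
  map_add' X Y := by
    ext p q
    exact congrFun (congrFun (E.map_add
      (Matrix.of fun s t => X (p.1, p.2.1, s) (q.1, q.2.1, t))
      (Matrix.of fun s t => Y (p.1, p.2.1, s) (q.1, q.2.1, t))) p.2.2) q.2.2
  map_smul' c X := by
    ext p q
    exact congrFun (congrFun (E.map_smul c
      (Matrix.of fun s t => X (p.1, p.2.1, s) (q.1, q.2.1, t))) p.2.2) q.2.2

/-- LOCC operations among the three senders, with an arbitrary finite number of rounds of classical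
communication. Either nothing is done, or one sender applies a local quantum instrument and
announces the outcome `x` to the others, after which the senders go on with an LOCC operation
`Λ x` that may depend on `x`. Output dimensions are arbitrary. -/
inductive IsLOCC {b₁ b₂ b₃ : ℕ} : {a₁ a₂ a₃ : ℕ} →
    (Op (Senders a₁ a₂ a₃) →ₗ[ℂ] Op (Senders b₁ b₂ b₃)) → Prop
  | refl : IsLOCC (LinearMap.id : Op (Senders b₁ b₂ b₃) →ₗ[ℂ] Op (Senders b₁ b₂ b₃))
  | step₁ {a₁ a₂ a₃ k : ℕ} {d : Fin k → ℕ}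
      (E : (x : Fin k) → Op (Fin a₁) →ₗ[ℂ] Op (Fin (d x)))
      (Λ : (x : Fin k) → Op (Senders (d x) a₂ a₃) →ₗ[ℂ] Op (Senders b₁ b₂ b₃))
      (hE : IsInstrument E) (hΛ : ∀ x, IsLOCC (Λ x)) :
      IsLOCC (∑ x, Λ x ∘ₗ local₁ a₂ a₃ (E x))
  | step₂ {a₁ a₂ a₃ k : ℕ} {d : Fin k → ℕ}
      (E : (x : Fin k) → Op (Fin a₂) →ₗ[ℂ] Op (Fin (d x)))
      (Λ : (x : Fin k) → Op (Senders a₁ (d x) a₃) →ₗ[ℂ] Op (Senders b₁ b₂ b₃))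
      (hE : IsInstrument E) (hΛ : ∀ x, IsLOCC (Λ x)) :
      IsLOCC (∑ x, Λ x ∘ₗ local₂ a₁ a₃ (E x))
  | step₃ {a₁ a₂ a₃ k : ℕ} {d : Fin k → ℕ}
      (E : (x : Fin k) → Op (Fin a₃) →ₗ[ℂ] Op (Fin (d x)))
      (Λ : (x : Fin k) → Op (Senders a₁ a₂ (d x)) →ₗ[ℂ] Op (Senders b₁ b₂ b₃))
      (hE : IsInstrument E) (hΛ : ∀ x, IsLOCC (Λ x)) :
      IsLOCC (∑ x, Λ x ∘ₗ local₃ a₁ a₂ (E x))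

/-! ### The quantum advantage of dense coding -/

/-- A class of operations on the senders' system, for all input and output dimensions. -/
abbrev OpClass : Type :=
  ∀ {a₁ a₂ a₃ b₁ b₂ b₃ : ℕ}, (Op (Senders a₁ a₂ a₃) →ₗ[ℂ] Op (Senders b₁ b₂ b₃)) → Prop

/-- The quantum advantage of dense coding from three senders to one receiver, when the senders are
restricted to the class `O` of operations:
`S(ρ_B) - inf S((Λ ⊗ id_B)[ρ])`, the infimum being over all `Λ` in `O` with any output dimensions.
It is an extended real, so that the infimum needs no convention. -/
def advantage (O : OpClass) {a₁ a₂ a₃ b : ℕ} (ρ : Op (Senders a₁ a₂ a₃ × Fin b)) : EReal :=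
  (entropy (traceFst ρ) : EReal) -
    ⨅ (b₁ : ℕ) (b₂ : ℕ) (b₃ : ℕ) (Λ : Op (Senders a₁ a₂ a₃) →ₗ[ℂ] Op (Senders b₁ b₂ b₃))
      (_ : O Λ), (entropy (onFst (Fin b) Λ ρ) : EReal)

/-- The advantage with global operations of the senders: all CPTP maps are allowed. -/
def advantageG {a₁ a₂ a₃ b : ℕ} (ρ : Op (Senders a₁ a₂ a₃ × Fin b)) : EReal :=
  advantage (fun Λ => IsCPTP Λ) ρ

/-- The advantage when the senders are restricted to LOCC among themselves. -/
def advantageLOCC {a₁ a₂ a₃ b : ℕ} (ρ : Op (Senders a₁ a₂ a₃ × Fin b)) : EReal :=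
  advantage (fun Λ => IsLOCC Λ) ρ

/-! ### The Smolin state -/

/-- The identity and the three Pauli matrices. -/
def pauli : Fin 4 → Op (Fin 2) :=
  ![1, !![0, 1; 1, 0], !![0, -Complex.I; Complex.I, 0], !![1, 0; 0, -1]]

/-- The maximally entangled vector `(|00⟩ + |11⟩) / √2`. -/
def psi₀ : Fin 2 × Fin 2 → ℂ := fun p => if p.1 = p.2 then ((Real.sqrt 2 : ℝ) : ℂ)⁻¹ else 0

/-- The Bell vectors `(σ_μ ⊗ 1) ψ₀`. -/
def bell (μ : Fin 4) : Fin 2 × Fin 2 → ℂ :=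
  (pauli μ ⊗ₖ (1 : Op (Fin 2))).mulVec psi₀

/-- The projector `|ψ_μ⟩⟨ψ_μ|`. -/
def bellProj (μ : Fin 4) : Op (Fin 2 × Fin 2) := Matrix.vecMulVec (bell μ) (star (bell μ))

/-- The Smolin state `¼ ∑ μ, |ψ_μ⟩⟨ψ_μ|_{A₁B} ⊗ |ψ_μ⟩⟨ψ_μ|_{A₂A₃}`, as an operator on
`(A₁A₂A₃)B`. -/
def smolin : Op (Senders 2 2 2 × Fin 2) :=
  (1 / 4 : ℂ) • ∑ μ, (bellProj μ ⊗ₖ bellProj μ).submatrix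
    (fun p => ((p.1.1, p.2), (p.1.2.1, p.1.2.2))) (fun p => ((p.1.1, p.2), (p.1.2.1, p.1.2.2)))

end DenseCoding

end

open DenseCoding

/-! A separable state obeys the reduction criterion `ρ ≤ ρ_A ⊗ 1`: on a product `P ⊗ Q` it amounts
to `Q ≤ (tr Q) 1`, and it survives sums. The criterion forces `S(A) ≤ S(AB)`
(`entropy_traceSnd_le`). With `a k`, `r j` the eigenvalues of `ρ_A` and `ρ`, and `p j k` the weight
of the `j`-th eigenvector of `ρ` on the `k`-th eigenvector of `ρ_A`, one has `∑ j, r j * p j k = a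
k`. The criterion yields `r j * ∑ k, p j k / a k ≤ 1`, and Jensen's inequality concludes
(`sum_negMulLog_le`).

The Smolin state is separable across `A₁B | A₂A₃` by its definition, and across `A₂B | A₁A₃` by its
symmetry under `A₁ ↔ A₂` (`sum_pauli_swap`). LOCC operations act inside the blocks of either cut and
preserve both properties. The first cut gives `S'(A₁B) ≤ S'`. The second makes the reduction to
`A₁B` separable, so `S'(B) ≤ S'(A₁B)`, and `S'(B) = S(B)` because the trace is preserved. Discarding
all senders' systems attains the bound, so the LOCC advantage is zero.

Globally, a Bell measurement of `A₂A₃` reveals `μ`, and `σ_μ` on `A₁` then leaves a pure Bell state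
with `B`: the entropy drops to 0 while `S(B) = 1`. -/

noncomputable section

namespace DenseCoding

open Matrix

/-! ### Entropy and eigenvalues -/

/-- The partial trace over the second factor. -/
def traceSnd {m n : Type} [Fintype n] (ρ : Op (m × n)) : Op m :=
  Matrix.of fun k l => ∑ i, ρ (k, i) (l, i)

theorem entropy_eq {n : Type} [Fintype n] [DecidableEq n] {ρ : Op n} (h : ρ.IsHermitian) :
    entropy ρ = (∑ i, Real.negMulLog (h.eigenvalues i)) / Real.log 2 := by
  unfold entropy
  rw [dif_pos h]

/-- The characteristic polynomial depends on neither the choice nor the ordering of an eigenbasis,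
which makes invariance under relabelling immediate. -/
theorem entropy_eq_roots {n : Type} [Fintype n] [DecidableEq n] {ρ : Op n} (h : ρ.IsHermitian) :
    entropy ρ = (ρ.charpoly.roots.map fun z => Real.negMulLog z.re).sum / Real.log 2 := by
  rw [entropy_eq h, h.roots_charpoly_eq_eigenvalues, Multiset.map_map]
  rfl

/-- Relabelling the basis does not change the entropy. -/
theorem entropy_submatrix {m n : Type} [Fintype m] [DecidableEq m] [Fintype n] [DecidableEq n]
    (e : m ≃ n) {ρ : Op n} (h : ρ.IsHermitian) : entropy (ρ.submatrix e e) = entropy ρ := by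
  rw [entropy_eq_roots h, entropy_eq_roots (h.submatrix e)]
  have := Matrix.charpoly_reindex e.symm ρ
  rw [Matrix.reindex_apply, Equiv.symm_symm] at this
  rw [this]

theorem entropy_of_isIdempotent {n : Type} [Fintype n] [DecidableEq n] {ρ : Op n}
    (h : ρ.IsHermitian) (hi : ρ * ρ = ρ) : entropy ρ = 0 := by
  rw [entropy_eq h, Finset.sum_eq_zero, zero_div]
  intro i _
  have hv := h.mulVec_eigenvectorBasis i
  have hne : (h.eigenvectorBasis i : n → ℂ) ≠ 0 := by
    simpa using h.eigenvectorBasis.orthonormal.ne_zero i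
  have h2 : (h.eigenvalues i * h.eigenvalues i) • (h.eigenvectorBasis i : n → ℂ)
      = h.eigenvalues i • (h.eigenvectorBasis i : n → ℂ) := by
    rw [mul_smul, ← hv, ← mulVec_smul, ← hv, mulVec_mulVec, hi]
  have h3 : h.eigenvalues i * h.eigenvalues i = h.eigenvalues i := smul_left_injective ℝ hne h2
  rcases mul_eq_zero.mp (show h.eigenvalues i * (h.eigenvalues i - 1) = 0 by linarith) with h0 | h1
  · simp [h0]
  · simp [sub_eq_zero.mp h1]

theorem entropy_smul_one {n : Type} [Fintype n] [DecidableEq n] (c : ℝ) :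
    entropy ((c : ℂ) • (1 : Op n)) = Fintype.card n * Real.negMulLog c / Real.log 2 := by
  have h : ((c : ℂ) • (1 : Op n)).IsHermitian := by
    ext i j
    by_cases hij : i = j <;> simp [hij, eq_comm]
  have key : ∀ i, h.eigenvalues i = c := by
    intro i
    have hv := h.mulVec_eigenvectorBasis i
    have hne : (h.eigenvectorBasis i : n → ℂ) ≠ 0 := by
      simpa using h.eigenvectorBasis.orthonormal.ne_zero i
    rw [smul_mulVec, one_mulVec] at hv
    exact (smul_left_injective ℝ hne hv).symm
  rw [entropy_eq h]
  simp [key]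

/-- Jensen's inequality for `-x log x`, with weights `r j * p j k / a k`. -/
theorem sum_negMulLog_le {J K : Type} [Fintype J] [Fintype K] (r : J → ℝ) (a : K → ℝ)
    (p : J → K → ℝ) (hr : ∀ j, 0 ≤ r j) (ha : ∀ k, 0 ≤ a k) (hp : ∀ j k, 0 ≤ p j k)
    (hp1 : ∀ j, ∑ k, p j k = 1) (hpa : ∀ k, ∑ j, r j * p j k = a k)
    (hc : ∀ j, r j * ∑ k, p j k / a k ≤ 1) :
    ∑ k, Real.negMulLog (a k) ≤ ∑ j, Real.negMulLog (r j) := by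
  -- Where `a k = 0` the division by zero is harmless, since the joint weights `r j * p j k` vanish
  -- there.
  have hz : ∀ j k, a k = 0 → r j * p j k = 0 := fun j k h =>
    (Finset.sum_eq_zero_iff_of_nonneg fun j _ => mul_nonneg (hr j) (hp j k)).mp
      ((hpa k).trans h) j (Finset.mem_univ j)
  have hrow : ∀ j, ∑ k, r j * p j k / a k * Real.negMulLog (a k) ≤ Real.negMulLog (r j) := by
    intro j
    -- The weights may sum to less than 1; the missing mass is put at the point 0, where `-x log x`
    -- vanishes. The weighted mean of the `a k` is `r j`.
    have := Real.concaveOn_negMulLog.map_add_sum_le (t := Finset.univ)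
      (w := fun k => r j * p j k / a k) (p := a) (v := 1 - r j * ∑ k, p j k / a k) (q := 0)
      (fun k _ => div_nonneg (mul_nonneg (hr j) (hp j k)) (ha k))
      (by simp only [Finset.mul_sum, mul_div_assoc]; ring) (fun k _ => ha k)
      (by linarith [hc j]) (by simp)
    simp only [smul_eq_mul, Real.negMulLog_zero, mul_zero, zero_add] at this
    refine this.trans_eq ?_
    congr 1
    calc ∑ k, r j * p j k / a k * a k = ∑ k, r j * p j k := by
          refine Finset.sum_congr rfl fun k _ => ?_
          by_cases h : a k = 0
          · rw [hz j k h]; simp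
          · field_simp
      _ = r j := by rw [← Finset.mul_sum, hp1, mul_one]
  refine le_trans (le_of_eq ?_) (Finset.sum_le_sum fun j _ => hrow j)
  rw [Finset.sum_comm]
  refine Finset.sum_congr rfl fun k _ => ?_
  rw [← Finset.sum_mul, ← Finset.sum_div, hpa]
  by_cases h : a k = 0
  · simp [h]
  · field_simp

theorem spectral_decomposition {n : Type} [Fintype n] [DecidableEq n] {A : Op n}
    (h : A.IsHermitian) : ∃ U : Op n, Uᴴ * U = 1 ∧ U * Uᴴ = 1 ∧
      A = U * diagonal (fun i => (h.eigenvalues i : ℂ)) * Uᴴ :=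
  ⟨h.eigenvectorUnitary, Unitary.coe_star_mul_self _, Unitary.coe_mul_star_self _, by
    conv_lhs => rw [h.spectral_theorem]
    rfl⟩

/-- For nonnegative `d`, each single term of this sum is a lower bound for the quadratic form. -/
theorem star_mulVec_dotProduct_diagonal {m J : Type} [Fintype m] [Fintype J] [DecidableEq J]
    (W : Matrix m J ℂ) (d : J → ℝ) (x : m → ℂ) :
    star x ⬝ᵥ ((W * diagonal (fun i => (d i : ℂ)) * Wᴴ) *ᵥ x)
      = ((∑ i, d i * Complex.normSq ((Wᴴ *ᵥ x) i) : ℝ) : ℂ) := by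
  rw [← mulVec_mulVec, ← mulVec_mulVec, dotProduct_mulVec]
  have : star x ᵥ* W = star (Wᴴ *ᵥ x) := by rw [star_mulVec, conjTranspose_conjTranspose]
  rw [this]
  simp only [dotProduct, mulVec_diagonal, Pi.star_apply, RCLike.star_def, Complex.ofReal_sum,
    Complex.ofReal_mul, Complex.normSq_eq_conj_mul_self]
  exact Finset.sum_congr rfl fun i _ => by ring

/-- The reduction criterion `ρ ≤ ρ_A ⊗ 1` implies `S(A) ≤ S(AB)`. -/
theorem entropy_traceSnd_le {m n : Type} [Fintype m] [DecidableEq m] [Fintype n] [DecidableEq n]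
    {ρ : Op (m × n)} (hρ : ρ.PosSemidef) (hσ : (traceSnd ρ).PosSemidef)
    (hred : (traceSnd ρ ⊗ₖ (1 : Op n) - ρ).PosSemidef) :
    entropy (traceSnd ρ) ≤ entropy ρ := by
  rw [entropy_eq hρ.1, entropy_eq hσ.1]
  refine div_le_div_of_nonneg_right ?_ (Real.log_nonneg one_le_two)
  obtain ⟨U, hU, hU', hUσ⟩ := spectral_decomposition hσ.1
  obtain ⟨V, hV, -, hVρ⟩ := spectral_decomposition hρ.1
  set a := hσ.1.eigenvalues
  set r := hρ.1.eigenvalues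
  have ha0 : ∀ k, 0 ≤ a k := hσ.eigenvalues_nonneg
  have hr0 : ∀ k, 0 ≤ r k := hρ.eigenvalues_nonneg
  -- `T` rotates the first factor to the eigenbasis of the reduced state; the columns of `W` are the
  -- eigenvectors of `ρ` in that basis.
  set T : Op (m × n) := Uᴴ ⊗ₖ (1 : Op n) with hT
  have hTH : Tᴴ = U ⊗ₖ (1 : Op n) := by simp [hT, conjTranspose_kronecker]
  set W : Op (m × n) := T * V with hW
  have hWρ : T * ρ * Tᴴ = W * diagonal (fun i => (r i : ℂ)) * Wᴴ := by
    rw [hW, conjTranspose_mul]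
    conv_lhs => rw [hVρ]
    simp only [Matrix.mul_assoc]
  have hTσ : T * (traceSnd ρ ⊗ₖ (1 : Op n)) * Tᴴ
      = diagonal (fun i => (a i : ℂ)) ⊗ₖ (1 : Op n) := by
    rw [hTH, hT, ← mul_kronecker_mul, ← mul_kronecker_mul]
    conv_lhs => rw [hUσ]
    have : Uᴴ * (U * diagonal (fun i => (a i : ℂ)) * Uᴴ) * U
        = (Uᴴ * U) * diagonal (fun i => (a i : ℂ)) * (Uᴴ * U) := by
      simp only [Matrix.mul_assoc]
    rw [this, hU]
    simp
  have hWW : Wᴴ * W = 1 := by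
    rw [hW, conjTranspose_mul, hTH, Matrix.mul_assoc, ← Matrix.mul_assoc _ T, hT,
      ← mul_kronecker_mul, hU']
    simp [hV]
  have hpsd := hred.mul_mul_conjTranspose_same T
  rw [mul_sub, sub_mul, hTσ, hWρ] at hpsd
  -- The rotated `ρ` has partial trace `diagonal a`; this becomes the identity `∑ j, r j * p j k = a
  -- k`.
  have hdiag : ∀ k, ∑ l, (W * diagonal (fun i => (r i : ℂ)) * Wᴴ) (k, l) (k, l) = a k := by
    intro k
    have h1 : ∑ l, (T * ρ * Tᴴ) (k, l) (k, l) = (Uᴴ * traceSnd ρ * U) k k := by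
      rw [hTH, hT]
      simp only [mul_apply, Fintype.sum_prod_type, kroneckerMap_apply, one_apply,
        traceSnd, of_apply, mul_ite, mul_one, mul_zero, ite_mul, zero_mul,
        Finset.sum_ite_eq, Finset.sum_ite_eq', Finset.mem_univ, if_true, Finset.sum_mul,
        Finset.mul_sum]
      rw [Finset.sum_comm]
      refine Finset.sum_congr rfl fun i _ => ?_
      rw [Finset.sum_comm]
    rw [← hWρ, h1]
    conv_lhs => rw [hUσ]
    have : Uᴴ * (U * diagonal (fun i => (a i : ℂ)) * Uᴴ) * U
        = (Uᴴ * U) * diagonal (fun i => (a i : ℂ)) * (Uᴴ * U) := by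
      simp only [Matrix.mul_assoc]
    rw [this, hU]
    simp
  refine sum_negMulLog_le r a (fun j k => ∑ l, Complex.normSq (W (k, l) j)) hr0 ha0
    (fun j k => Finset.sum_nonneg fun l _ => Complex.normSq_nonneg _) ?_ ?_ ?_
  · intro j
    have := congrFun (congrFun hWW j) j
    rw [mul_apply, Fintype.sum_prod_type, one_apply_eq] at this
    simp only [conjTranspose_apply, RCLike.star_def, ← Complex.normSq_eq_conj_mul_self] at this
    exact_mod_cast this
  · intro k
    have : ∑ l, ∑ y, (W * diagonal (fun i => (r i : ℂ))) (k, l) y * Wᴴ y (k, l) = a k := hdiag k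
    simp only [mul_diagonal, conjTranspose_apply, RCLike.star_def] at this
    rw [Finset.sum_comm] at this
    rw [← Complex.ofReal_inj, ← this]
    push_cast
    refine Finset.sum_congr rfl fun j _ => ?_
    rw [Finset.mul_sum]
    refine Finset.sum_congr rfl fun l _ => ?_
    rw [Complex.normSq_eq_conj_mul_self]
    ring
  · intro j
    set c : ℝ := ∑ k, (∑ l, Complex.normSq (W (k, l) j)) / a k with hc
    -- The test vector is `σ⁻¹ w` (a pseudo-inverse where `a k = 0`), with `w` the `j`-th column of
    -- `W` and `σ = diagonal a ⊗ 1`. Then `⟨w, x⟩ = ⟨x, σ x⟩ = c`, so the reduction criterion gives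
    -- `r j * c² ≤ c`.
    set x : m × n → ℂ := fun q => ((a q.1)⁻¹ : ℝ) * W q j with hx
    have hx1 : (Wᴴ *ᵥ x) j = c := by
      simp only [mulVec, dotProduct, Fintype.sum_prod_type, conjTranspose_apply, RCLike.star_def,
        hx, hc, Complex.ofReal_sum, Finset.sum_div]
      refine Finset.sum_congr rfl fun k _ => Finset.sum_congr rfl fun l _ => ?_
      push_cast
      rw [Complex.normSq_eq_conj_mul_self]
      ring
    have hx2 : star x ⬝ᵥ ((diagonal (fun i => (a i : ℂ)) ⊗ₖ (1 : Op n)) *ᵥ x) = c := by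
      have : diagonal (fun i => (a i : ℂ)) ⊗ₖ (1 : Op n) = diagonal fun q => (a q.1 : ℂ) := by
        rw [← diagonal_one, diagonal_kronecker_diagonal]
        simp
      rw [this]
      simp only [dotProduct, mulVec_diagonal, Fintype.sum_prod_type, Pi.star_apply,
        RCLike.star_def, hx, hc, Complex.ofReal_sum, Finset.sum_div, map_mul, Complex.conj_ofReal]
      refine Finset.sum_congr rfl fun k _ => Finset.sum_congr rfl fun l _ => ?_
      push_cast
      rw [Complex.normSq_eq_conj_mul_self]
      by_cases h : a k = 0
      · simp [h]
      · have : (a k : ℂ) ≠ 0 := by exact_mod_cast h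
        field_simp
    have h := hpsd.dotProduct_mulVec_nonneg x
    rw [sub_mulVec, dotProduct_sub, hx2, star_mulVec_dotProduct_diagonal, sub_nonneg] at h
    have h' : ∑ i, r i * Complex.normSq ((Wᴴ *ᵥ x) i) ≤ c := by exact_mod_cast h
    have h3 : r j * Complex.normSq ((Wᴴ *ᵥ x) j) ≤ c :=
      (Finset.single_le_sum (f := fun i => r i * Complex.normSq ((Wᴴ *ᵥ x) i))
        (fun i _ => mul_nonneg (hr0 i) (Complex.normSq_nonneg _)) (Finset.mem_univ j)).trans h'
    rw [hx1, Complex.normSq_ofReal] at h3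
    have hc0 : 0 ≤ c := Finset.sum_nonneg fun k _ =>
      div_nonneg (Finset.sum_nonneg fun l _ => Complex.normSq_nonneg _) (ha0 k)
    rcases hc0.eq_or_lt with h0 | hpos
    · rw [← h0]; simp
    · exact le_of_mul_le_mul_right (by linarith) hpos

end DenseCoding

namespace DenseCoding

open Matrix

/-! ### Separable operators -/

theorem traceFst_posSemidef {m n : Type} [Fintype m] {ρ : Op (m × n)} (h : ρ.PosSemidef) :
    (traceFst ρ).PosSemidef := by
  have : traceFst ρ = ∑ i, ρ.submatrix (fun k => (i, k)) (fun k => (i, k)) := by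
    ext k l
    simp [traceFst, Matrix.sum_apply]
  rw [this]
  exact Matrix.posSemidef_sum _ fun i _ => h.submatrix _

theorem traceSnd_posSemidef {m n : Type} [Fintype n] {ρ : Op (m × n)} (h : ρ.PosSemidef) :
    (traceSnd ρ).PosSemidef :=
  traceFst_posSemidef (h.submatrix Prod.swap)

/-- Each eigenvalue of `Q` is at most the sum of them all. This is the reduction criterion for
products. -/
theorem trace_smul_one_sub_posSemidef {n : Type} [Fintype n] [DecidableEq n] {Q : Op n}
    (h : Q.PosSemidef) : (Q.trace • (1 : Op n) - Q).PosSemidef := by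
  obtain ⟨U, -, hU, hQ⟩ := spectral_decomposition h.1
  have h1 : Q.trace • (1 : Op n) - Q
      = U * diagonal (fun i => Q.trace - (h.1.eigenvalues i : ℂ)) * Uᴴ := by
    have : diagonal (fun i => Q.trace - (h.1.eigenvalues i : ℂ))
        = Q.trace • (1 : Op n) - diagonal (fun i => (h.1.eigenvalues i : ℂ)) := by
      ext i j
      by_cases hij : i = j <;> simp [hij]
    rw [this, mul_sub, sub_mul, ← hQ]
    simp [hU]
  rw [h1]
  refine PosSemidef.mul_mul_conjTranspose_same (PosSemidef.diagonal fun i => ?_) U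
  rw [Pi.zero_apply, sub_nonneg, h.1.trace_eq_sum_eigenvalues]
  exact Finset.single_le_sum (f := fun i => (h.1.eigenvalues i : ℂ))
    (fun i _ => Complex.zero_le_real.mpr (h.eigenvalues_nonneg i)) (Finset.mem_univ i)

/-- The cone of separable (unnormalized) operators of a bipartite system. -/
def separable (m n : Type) : AddSubmonoid (Op (m × n)) :=
  AddSubmonoid.closure {X | ∃ (P : Op m) (Q : Op n), P.PosSemidef ∧ Q.PosSemidef ∧ X = P ⊗ₖ Q}

theorem kronecker_mem_separable {m n : Type} {P : Op m} {Q : Op n} (hP : P.PosSemidef)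
    (hQ : Q.PosSemidef) : P ⊗ₖ Q ∈ separable m n :=
  AddSubmonoid.subset_closure ⟨P, Q, hP, hQ, rfl⟩

/-- Reduces any additive property of separable operators to product operators. -/
theorem map_mem_separable {m n : Type} {A : Type*} [AddCommMonoid A] (S : AddSubmonoid A)
    (f : Op (m × n) →+ A) (hf : ∀ P Q, P.PosSemidef → Q.PosSemidef → f (P ⊗ₖ Q) ∈ S)
    {X : Op (m × n)} (hX : X ∈ separable m n) : f X ∈ S := by
  have : separable m n ≤ S.comap f :=
    AddSubmonoid.closure_le.mpr (by rintro _ ⟨P, Q, hP, hQ, rfl⟩; exact hf P Q hP hQ)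
  exact this hX

/-- The positive semidefinite matrices form an additive submonoid. -/
def posSemidefCone (n : Type) : AddSubmonoid (Op n) where
  carrier := {X | X.PosSemidef}
  zero_mem' := PosSemidef.zero
  add_mem' h h' := PosSemidef.add h h'

/-- Relabelling of a matrix, as an additive map. -/
def submatrixHom {m n : Type} (e : m → n) : Op n →+ Op m where
  toFun X := X.submatrix e e
  map_zero' := rfl
  map_add' _ _ := rfl

/-- The partial trace over the second factor, as an additive map. -/
def traceSndHom (m n : Type) [Fintype n] : Op (m × n) →+ Op m where
  toFun := traceSnd
  map_zero' := by ext; simp [traceSnd]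
  map_add' X Y := by ext; simp [traceSnd, Finset.sum_add_distrib]

theorem traceSnd_kronecker {m n : Type} [Fintype n] (P : Op m) (Q : Op n) :
    traceSnd (P ⊗ₖ Q) = Q.trace • P := by
  ext i j
  simp [traceSnd, Matrix.trace, ← Finset.mul_sum, mul_comm]

theorem separable.posSemidef {m n : Type} [Finite m] [Finite n] {X : Op (m × n)}
    (hX : X ∈ separable m n) : X.PosSemidef :=
  map_mem_separable (posSemidefCone _) (AddMonoidHom.id _)
    (fun _ _ hP hQ => hP.kronecker hQ) hX

theorem separable.swap {m n : Type} {X : Op (m × n)} (hX : X ∈ separable m n) :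
    X.submatrix Prod.swap Prod.swap ∈ separable n m := by
  refine map_mem_separable (separable n m) (submatrixHom Prod.swap) (fun P Q hP hQ => ?_) hX
  change (P ⊗ₖ Q).submatrix Prod.swap Prod.swap ∈ _
  have : (P ⊗ₖ Q).submatrix Prod.swap Prod.swap = Q ⊗ₖ P := by
    ext i j
    simp [mul_comm]
  rw [this]
  exact kronecker_mem_separable hQ hP

/-- Separable operators satisfy the reduction criterion. -/
theorem separable.reduction {m n : Type} [Finite m] [Fintype n] [DecidableEq n] {X : Op (m × n)}
    (hX : X ∈ separable m n) : (traceSnd X ⊗ₖ (1 : Op n) - X).PosSemidef := by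
  refine map_mem_separable (posSemidefCone _)
    (AddMonoidHom.mk' (fun X => traceSnd X ⊗ₖ (1 : Op n) - X) fun X Y => ?_)
    (fun P Q hP hQ => ?_) hX
  · ext i j
    simp [traceSnd, Finset.sum_add_distrib]
    ring
  change (traceSnd (P ⊗ₖ Q) ⊗ₖ (1 : Op n) - P ⊗ₖ Q).PosSemidef
  have : traceSnd (P ⊗ₖ Q) ⊗ₖ (1 : Op n) - P ⊗ₖ Q = P ⊗ₖ (Q.trace • (1 : Op n) - Q) := by
    rw [traceSnd_kronecker]
    ext i j
    simp
    ring
  rw [this]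
  exact hP.kronecker (trace_smul_one_sub_posSemidef hQ)

/-- For separable states the entropy of a part is at most the entropy of the whole. -/
theorem separable.entropy_traceSnd_le {m n : Type} [Fintype m] [DecidableEq m] [Fintype n]
    [DecidableEq n] {X : Op (m × n)} (hX : X ∈ separable m n) :
    entropy (traceSnd X) ≤ entropy X :=
  DenseCoding.entropy_traceSnd_le (separable.posSemidef hX)
    (traceSnd_posSemidef (separable.posSemidef hX)) (separable.reduction hX)

theorem separable.entropy_traceFst_le {m n : Type} [Fintype m] [DecidableEq m] [Fintype n]
    [DecidableEq n] {X : Op (m × n)} (hX : X ∈ separable m n) :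
    entropy (traceFst X) ≤ entropy X := by
  rw [← entropy_submatrix (Equiv.prodComm n m) (separable.posSemidef hX).1]
  exact separable.entropy_traceSnd_le (separable.swap hX)

/-! ### Local operations on separable operators -/

/-- The map `id ⊗ Λ` obtained by letting `Λ` act on the second factor of a bipartite system. -/
def onSnd {m n : Type} (r : Type) (Λ : Op m →ₗ[ℂ] Op n) (X : Op (r × m)) : Op (r × n) :=
  (onFst r Λ (X.submatrix Prod.swap Prod.swap)).submatrix Prod.swap Prod.swap

/-- The map `id ⊗ Λ` as a linear map. -/
def onSndₗ {m n : Type} (r : Type) (Λ : Op m →ₗ[ℂ] Op n) : Op (r × m) →ₗ[ℂ] Op (r × n) where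
  toFun := onSnd r Λ
  map_add' X Y := by
    ext p q
    exact congrFun (congrFun ((onFst r Λ).map_add (X.submatrix Prod.swap Prod.swap)
      (Y.submatrix Prod.swap Prod.swap)) p.swap) q.swap
  map_smul' c X := by
    ext p q
    exact congrFun (congrFun ((onFst r Λ).map_smul c (X.submatrix Prod.swap Prod.swap)) p.swap) q.swap

/-- Linear maps that preserve positive semidefiniteness. -/
def IsPositiveMap {m n : Type} (Φ : Op m →ₗ[ℂ] Op n) : Prop :=
  ∀ X, X.PosSemidef → (Φ X).PosSemidef

theorem IsCP.onFst_isPositive {m n : Type} {E : Op m →ₗ[ℂ] Op n} (hE : IsCP E) (k : ℕ) :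
    IsPositiveMap (onFst (Fin k) E) := hE k

theorem IsCP.onSnd_isPositive {m n : Type} {E : Op m →ₗ[ℂ] Op n} (hE : IsCP E) (k : ℕ) :
    IsPositiveMap (onSndₗ (Fin k) E) :=
  fun _ hX => (hE k _ (hX.submatrix Prod.swap)).submatrix Prod.swap

theorem onFst_kronecker {m n r : Type} (Φ : Op m →ₗ[ℂ] Op n) (P : Op m) (Q : Op r) :
    onFst r Φ (P ⊗ₖ Q) = Φ P ⊗ₖ Q := by
  ext p q
  have : (Matrix.of fun s t => (P ⊗ₖ Q) (s, p.2) (t, q.2)) = Q p.2 q.2 • P := by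
    ext s t
    simp [mul_comm]
  change Φ (Matrix.of fun s t => (P ⊗ₖ Q) (s, p.2) (t, q.2)) p.1 q.1 = _
  rw [this, map_smul]
  simp [mul_comm]

/-- Positivity of `Φ` suffices, as it only meets the factor `P`. Complete positivity of a sender's
map is needed beforehand, to extend it to the whole block containing that sender. -/
theorem onFst_mem_separable {m n r : Type} {Φ : Op m →ₗ[ℂ] Op n} (hΦ : IsPositiveMap Φ)
    {X : Op (m × r)} (hX : X ∈ separable m r) : onFst r Φ X ∈ separable n r := by
  refine map_mem_separable (separable n r) (onFst r Φ).toAddMonoidHom (fun P Q hP hQ => ?_) hX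
  change onFst r Φ (P ⊗ₖ Q) ∈ _
  rw [onFst_kronecker]
  exact kronecker_mem_separable (hΦ P hP) hQ

theorem onSnd_mem_separable {m n r : Type} {Φ : Op m →ₗ[ℂ] Op n} (hΦ : IsPositiveMap Φ)
    {X : Op (r × m)} (hX : X ∈ separable r m) : onSnd r Φ X ∈ separable r n :=
  separable.swap (onFst_mem_separable hΦ (separable.swap hX))

/-! ### LOCC operations -/

theorem onFst_sum_comp {m n r : Type} {ι : Type*} [Fintype ι] {l : ι → Type}
    (Λ : (x : ι) → Op (l x) →ₗ[ℂ] Op n) (E : (x : ι) → Op m →ₗ[ℂ] Op (l x)) (X : Op (m × r)) :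
    onFst r (∑ x, Λ x ∘ₗ E x) X = ∑ x, onFst r (Λ x) (onFst r (E x) X) := by
  ext p q
  rw [Matrix.sum_apply]
  change (∑ x, Λ x ∘ₗ E x) (Matrix.of fun s t => X (s, p.2) (t, q.2)) p.1 q.1 = _
  rw [LinearMap.sum_apply, Matrix.sum_apply]
  rfl

/-- A family of cones preserved by completely positive maps of each sender is preserved by LOCC
operations. -/
theorem IsLOCC.mem_cone {b : Type} (C : ∀ a₁ a₂ a₃ : ℕ, AddSubmonoid (Op (Senders a₁ a₂ a₃ × b)))
    (h₁ : ∀ {a₁ a₂ a₃ d : ℕ} (E : Op (Fin a₁) →ₗ[ℂ] Op (Fin d)) (X), IsCP E → X ∈ C a₁ a₂ a₃ →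
      onFst b (local₁ a₂ a₃ E) X ∈ C d a₂ a₃)
    (h₂ : ∀ {a₁ a₂ a₃ d : ℕ} (E : Op (Fin a₂) →ₗ[ℂ] Op (Fin d)) (X), IsCP E → X ∈ C a₁ a₂ a₃ →
      onFst b (local₂ a₁ a₃ E) X ∈ C a₁ d a₃)
    (h₃ : ∀ {a₁ a₂ a₃ d : ℕ} (E : Op (Fin a₃) →ₗ[ℂ] Op (Fin d)) (X), IsCP E → X ∈ C a₁ a₂ a₃ →
      onFst b (local₃ a₁ a₂ E) X ∈ C a₁ a₂ d)
    {a₁ a₂ a₃ b₁ b₂ b₃ : ℕ} {Λ : Op (Senders a₁ a₂ a₃) →ₗ[ℂ] Op (Senders b₁ b₂ b₃)}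
    (hΛ : IsLOCC Λ) : ∀ X ∈ C a₁ a₂ a₃, onFst b Λ X ∈ C b₁ b₂ b₃ := by
  induction hΛ with
  | refl => exact fun X hX => hX
  | step₁ E Λ hE _ ih =>
    intro X hX
    rw [onFst_sum_comp]
    -- The branches of all outcomes recombine because the cone is closed under sums; no
    -- normalization is needed.
    exact AddSubmonoid.sum_mem _ fun x _ => ih x _ (h₁ _ _ (hE.cp x) hX)
  | step₂ E Λ hE _ ih =>
    intro X hX
    rw [onFst_sum_comp]
    exact AddSubmonoid.sum_mem _ fun x _ => ih x _ (h₂ _ _ (hE.cp x) hX)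
  | step₃ E Λ hE _ ih =>
    intro X hX
    rw [onFst_sum_comp]
    exact AddSubmonoid.sum_mem _ fun x _ => ih x _ (h₃ _ _ (hE.cp x) hX)

/-- Grouping of the subsystems as `A₁B | A₂A₃`. -/
def cut₁ (α₁ α₂ α₃ β : Type) : (α₁ × β) × (α₂ × α₃) ≃ (α₁ × α₂ × α₃) × β where
  toFun p := ((p.1.1, p.2.1, p.2.2), p.1.2)
  invFun p := ((p.1.1, p.2), (p.1.2.1, p.1.2.2))
  left_inv _ := rfl
  right_inv _ := rfl

/-- Grouping of the subsystems as `A₂B | A₁A₃`. -/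
def cut₂ (α₁ α₂ α₃ β : Type) : (α₂ × β) × (α₁ × α₃) ≃ (α₁ × α₂ × α₃) × β where
  toFun p := ((p.2.1, p.1.1, p.2.2), p.1.2)
  invFun p := ((p.1.2.1, p.2), (p.1.1, p.1.2.2))
  left_inv _ := rfl
  right_inv _ := rfl

/-- Operators that are separable across `A₁B | A₂A₃`. -/
def separable₁ (b a₁ a₂ a₃ : ℕ) : AddSubmonoid (Op (Senders a₁ a₂ a₃ × Fin b)) :=
  (separable (Fin a₁ × Fin b) (Fin a₂ × Fin a₃)).comap (submatrixHom (cut₁ _ _ _ _))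

/-- Operators that are separable across `A₂B | A₁A₃`. -/
def separable₂ (b a₁ a₂ a₃ : ℕ) : AddSubmonoid (Op (Senders a₁ a₂ a₃ × Fin b)) :=
  (separable (Fin a₂ × Fin b) (Fin a₁ × Fin a₃)).comap (submatrixHom (cut₂ _ _ _ _))

/-- Maps of `A₁` act inside the block `A₁B`, and those of `A₂` or `A₃` inside `A₂A₃`. After
regrouping by `cut₁`, each is definitionally an `onFst` or `onSnd` of a positive map. -/
theorem IsLOCC.mem_separable₁ {b a₁ a₂ a₃ b₁ b₂ b₃ : ℕ}
    {Λ : Op (Senders a₁ a₂ a₃) →ₗ[ℂ] Op (Senders b₁ b₂ b₃)} (hΛ : IsLOCC Λ)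
    {X : Op (Senders a₁ a₂ a₃ × Fin b)} (hX : X ∈ separable₁ b a₁ a₂ a₃) :
    onFst (Fin b) Λ X ∈ separable₁ b b₁ b₂ b₃ :=
  hΛ.mem_cone (separable₁ b)
    (fun _ _ hE h => onFst_mem_separable (hE.onFst_isPositive b) h)
    (fun {_ _ a₃ _} _ _ hE h => onSnd_mem_separable (hE.onFst_isPositive a₃) h)
    (fun {_ a₂ _ _} _ _ hE h => onSnd_mem_separable (hE.onSnd_isPositive a₂) h) X hX

theorem IsLOCC.mem_separable₂ {b a₁ a₂ a₃ b₁ b₂ b₃ : ℕ}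
    {Λ : Op (Senders a₁ a₂ a₃) →ₗ[ℂ] Op (Senders b₁ b₂ b₃)} (hΛ : IsLOCC Λ)
    {X : Op (Senders a₁ a₂ a₃ × Fin b)} (hX : X ∈ separable₂ b a₁ a₂ a₃) :
    onFst (Fin b) Λ X ∈ separable₂ b b₁ b₂ b₃ :=
  hΛ.mem_cone (separable₂ b)
    (fun {_ _ a₃ _} _ _ hE h => onSnd_mem_separable (hE.onFst_isPositive a₃) h)
    (fun _ _ hE h => onFst_mem_separable (hE.onFst_isPositive b) h)
    (fun {a₁ _ _ _} _ _ hE h => onSnd_mem_separable (hE.onSnd_isPositive a₁) h) X hX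

theorem IsInstrument.sum_trace_local₁ {a₁ a₂ a₃ k : ℕ} {d : Fin k → ℕ}
    {E : (x : Fin k) → Op (Fin a₁) →ₗ[ℂ] Op (Fin (d x))} (hE : IsInstrument E)
    (X : Op (Senders a₁ a₂ a₃)) : ∑ x, (local₁ a₂ a₃ (E x) X).trace = X.trace := by
  have h : ∀ x, (local₁ a₂ a₃ (E x) X).trace
      = ∑ j, (E x (Matrix.of fun s t => X (s, j) (t, j))).trace := fun x => by
    simp only [Matrix.trace, Matrix.diag_apply]
    rw [Fintype.sum_prod_type, Finset.sum_comm]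
    rfl
  simp only [h]
  rw [Finset.sum_comm]
  simp only [hE.tp]
  exact Finset.sum_comm.trans (Fintype.sum_prod_type fun p => X p p).symm

theorem IsInstrument.sum_trace_local₂ {a₁ a₂ a₃ k : ℕ} {d : Fin k → ℕ}
    {E : (x : Fin k) → Op (Fin a₂) →ₗ[ℂ] Op (Fin (d x))} (hE : IsInstrument E)
    (X : Op (Senders a₁ a₂ a₃)) : ∑ x, (local₂ a₁ a₃ (E x) X).trace = X.trace := by
  have h : ∀ x, (local₂ a₁ a₃ (E x) X).trace
      = ∑ i, ∑ j, (E x (Matrix.of fun s t => X (i, s, j) (i, t, j))).trace := fun x => by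
    simp only [Matrix.trace, Matrix.diag_apply]
    rw [Fintype.sum_prod_type]
    refine Finset.sum_congr rfl fun i _ => ?_
    rw [Fintype.sum_prod_type, Finset.sum_comm]
    rfl
  simp only [h]
  rw [Finset.sum_comm, Matrix.trace, Fintype.sum_prod_type]
  refine Finset.sum_congr rfl fun i _ => ?_
  rw [Finset.sum_comm]
  simp only [hE.tp]
  rw [Fintype.sum_prod_type, Finset.sum_comm]
  rfl

theorem IsInstrument.sum_trace_local₃ {a₁ a₂ a₃ k : ℕ} {d : Fin k → ℕ}
    {E : (x : Fin k) → Op (Fin a₃) →ₗ[ℂ] Op (Fin (d x))} (hE : IsInstrument E)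
    (X : Op (Senders a₁ a₂ a₃)) : ∑ x, (local₃ a₁ a₂ (E x) X).trace = X.trace := by
  have h : ∀ x, (local₃ a₁ a₂ (E x) X).trace
      = ∑ i, ∑ j, (E x (Matrix.of fun s t => X (i, j, s) (i, j, t))).trace := fun x => by
    simp only [Matrix.trace, Matrix.diag_apply, Fintype.sum_prod_type]
    rfl
  simp only [h]
  rw [Finset.sum_comm, Matrix.trace, Fintype.sum_prod_type]
  refine Finset.sum_congr rfl fun i _ => ?_
  rw [Finset.sum_comm]
  simp only [hE.tp]
  rw [Fintype.sum_prod_type]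
  rfl

/-- LOCC operations preserve the trace. -/
theorem IsLOCC.trace_eq {a₁ a₂ a₃ b₁ b₂ b₃ : ℕ}
    {Λ : Op (Senders a₁ a₂ a₃) →ₗ[ℂ] Op (Senders b₁ b₂ b₃)} (hΛ : IsLOCC Λ) :
    ∀ X, (Λ X).trace = X.trace := by
  induction hΛ with
  | refl => exact fun _ => rfl
  | step₁ E Λ hE _ ih =>
    intro X
    simp only [LinearMap.sum_apply, LinearMap.comp_apply, Matrix.trace_sum, ih,
      hE.sum_trace_local₁]
  | step₂ E Λ hE _ ih =>
    intro X
    simp only [LinearMap.sum_apply, LinearMap.comp_apply, Matrix.trace_sum, ih,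
      hE.sum_trace_local₂]
  | step₃ E Λ hE _ ih =>
    intro X
    simp only [LinearMap.sum_apply, LinearMap.comp_apply, Matrix.trace_sum, ih,
      hE.sum_trace_local₃]

/-- No signalling: the senders cannot change the receiver's state. -/
theorem traceFst_onFst {m n r : Type} [Fintype m] [Fintype n] {Λ : Op m →ₗ[ℂ] Op n}
    (hΛ : ∀ X, (Λ X).trace = X.trace) (X : Op (m × r)) : traceFst (onFst r Λ X) = traceFst X := by
  ext k l
  exact hΛ (Matrix.of fun s t => X (s, k) (t, l))

theorem reduceA₁B_eq_traceSnd {a₁ a₂ a₃ b : ℕ} (X : Op (Senders a₁ a₂ a₃ × Fin b)) :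
    reduceA₁B X = traceSnd (X.submatrix (cut₁ _ _ _ _) (cut₁ _ _ _ _)) := by
  ext p q
  simp [reduceA₁B, traceSnd, cut₁, Fintype.sum_prod_type]

theorem traceFst_reduceA₁B {a₁ a₂ a₃ b : ℕ} (X : Op (Senders a₁ a₂ a₃ × Fin b)) :
    traceFst (reduceA₁B X) = traceFst X := by
  ext p q
  simp [reduceA₁B, traceFst, Fintype.sum_prod_type]

/-- Tracing `A₂A₃` out of `P_{A₂B} ⊗ Q_{A₁A₃}` leaves the product of `tr_{A₃} Q` on `A₁` and
`tr_{A₂} P` on `B`. -/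
theorem reduceA₁B_mem_separable {a₁ a₂ a₃ b : ℕ} {X : Op (Senders a₁ a₂ a₃ × Fin b)}
    (hX : X ∈ separable₂ b a₁ a₂ a₃) : reduceA₁B X ∈ separable (Fin a₁) (Fin b) := by
  have h := map_mem_separable (separable (Fin a₁) (Fin b))
    (((traceSndHom (Fin a₁ × Fin b) (Fin a₂ × Fin a₃)).comp (submatrixHom (cut₁ _ _ _ _))).comp
      (submatrixHom (cut₂ _ _ _ _).symm)) (fun P Q hP hQ => ?_) hX
  · rw [reduceA₁B_eq_traceSnd]
    exact h
  · have := kronecker_mem_separable (traceSnd_posSemidef hQ) (traceFst_posSemidef hP)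
    convert this using 1
    ext p q
    simp [traceSndHom, submatrixHom, cut₁, cut₂, traceSnd, traceFst, Fintype.sum_prod_type,
      Finset.sum_mul_sum, mul_comm]

/-- The entropy of `A₁B` does not exceed the total entropy after an LOCC operation on a state that
is separable across `A₁B | A₂A₃`. -/
theorem IsLOCC.entropy_reduceA₁B_le {b a₁ a₂ a₃ b₁ b₂ b₃ : ℕ}
    {Λ : Op (Senders a₁ a₂ a₃) →ₗ[ℂ] Op (Senders b₁ b₂ b₃)} (hΛ : IsLOCC Λ)
    {X : Op (Senders a₁ a₂ a₃ × Fin b)} (hX : X ∈ separable₁ b a₁ a₂ a₃) :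
    entropy (reduceA₁B (onFst (Fin b) Λ X)) ≤ entropy (onFst (Fin b) Λ X) := by
  have h : (onFst (Fin b) Λ X).submatrix (cut₁ _ _ _ _) (cut₁ _ _ _ _) ∈ separable _ _ :=
    hΛ.mem_separable₁ hX
  have hH : (onFst (Fin b) Λ X).IsHermitian :=
    ((Matrix.posSemidef_submatrix_equiv _).mp (separable.posSemidef h)).1
  rw [reduceA₁B_eq_traceSnd, ← entropy_submatrix (cut₁ _ _ _ _) hH]
  exact separable.entropy_traceSnd_le h

/-- The entropy of the receiver does not exceed that of `A₁B` after an LOCC operation on a state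
that is separable across `A₂B | A₁A₃`. -/
theorem IsLOCC.entropy_traceFst_le {b a₁ a₂ a₃ b₁ b₂ b₃ : ℕ}
    {Λ : Op (Senders a₁ a₂ a₃) →ₗ[ℂ] Op (Senders b₁ b₂ b₃)} (hΛ : IsLOCC Λ)
    {X : Op (Senders a₁ a₂ a₃ × Fin b)} (hX : X ∈ separable₂ b a₁ a₂ a₃) :
    entropy (traceFst X) ≤ entropy (reduceA₁B (onFst (Fin b) Λ X)) := by
  have := separable.entropy_traceFst_le (reduceA₁B_mem_separable (hΛ.mem_separable₂ hX))
  rwa [traceFst_reduceA₁B, traceFst_onFst hΛ.trace_eq] at this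

end DenseCoding

namespace DenseCoding

open Matrix

/-! ### The Smolin state -/

theorem bell_apply (μ : Fin 4) (p : Fin 2 × Fin 2) :
    bell μ p = pauli μ p.1 p.2 * ((Real.sqrt 2 : ℝ) : ℂ)⁻¹ := by
  obtain ⟨a, b⟩ := p
  simp [bell, mulVec, dotProduct, psi₀, Fintype.sum_prod_type, Matrix.one_apply]

theorem inv_sqrt_two_mul_self :
    ((Real.sqrt 2 : ℝ) : ℂ)⁻¹ * ((Real.sqrt 2 : ℝ) : ℂ)⁻¹ = 1 / 2 := by
  rw [← mul_inv, ← Complex.ofReal_mul, Real.mul_self_sqrt zero_le_two]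
  norm_num

theorem star_inv_sqrt_two : star ((Real.sqrt 2 : ℝ) : ℂ)⁻¹ = ((Real.sqrt 2 : ℝ) : ℂ)⁻¹ := by
  rw [star_inv₀, RCLike.star_def, Complex.conj_ofReal]

theorem bellProj_apply (μ : Fin 4) (p q : Fin 2 × Fin 2) :
    bellProj μ p q = 1 / 2 * (pauli μ p.1 p.2 * star (pauli μ q.1 q.2)) := by
  rw [← inv_sqrt_two_mul_self, bellProj, vecMulVec_apply, Pi.star_apply, bell_apply, bell_apply,
    star_mul', star_inv_sqrt_two]
  ring

theorem bellProj_posSemidef (μ : Fin 4) : (bellProj μ).PosSemidef :=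
  posSemidef_vecMulVec_self_star _

theorem smolin_apply (p q : Senders 2 2 2 × Fin 2) :
    smolin p q = 1 / 4 * ∑ μ, bellProj μ (p.1.1, p.2) (q.1.1, q.2) *
      bellProj μ (p.1.2.1, p.1.2.2) (q.1.2.1, q.1.2.2) := by
  simp [smolin, Matrix.sum_apply]

/-- The Fierz identities for the Pauli matrices. -/
theorem pauli_fierz (a b c d : Fin 2) :
    pauli 0 b d * pauli 0 a c = 1 / 2 * (pauli 0 a d * pauli 0 b c + pauli 1 a d * pauli 1 b c
      + pauli 2 a d * pauli 2 b c + pauli 3 a d * pauli 3 b c) ∧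
    pauli 1 b d * pauli 1 a c = 1 / 2 * (pauli 0 a d * pauli 0 b c + pauli 1 a d * pauli 1 b c
      - pauli 2 a d * pauli 2 b c - pauli 3 a d * pauli 3 b c) ∧
    pauli 2 b d * pauli 2 a c = 1 / 2 * (pauli 0 a d * pauli 0 b c - pauli 1 a d * pauli 1 b c
      + pauli 2 a d * pauli 2 b c - pauli 3 a d * pauli 3 b c) ∧
    pauli 3 b d * pauli 3 a c = 1 / 2 * (pauli 0 a d * pauli 0 b c - pauli 1 a d * pauli 1 b c
      - pauli 2 a d * pauli 2 b c + pauli 3 a d * pauli 3 b c) := by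
  fin_cases a <;> fin_cases b <;> fin_cases c <;> fin_cases d <;> simp [pauli] <;> norm_num

/-- The Fierz coefficients form half a 4×4 Hadamard matrix, which is real orthogonal, so a sum of
the form `∑ μ, v μ * star (v' μ)` is unchanged by the regrouping. -/
theorem sum_pauli_swap (a b c d a' b' c' d' : Fin 2) :
    ∑ μ, pauli μ a d * star (pauli μ a' d') * (pauli μ b c * star (pauli μ b' c'))
      = ∑ μ, pauli μ b d * star (pauli μ b' d') * (pauli μ a c * star (pauli μ a' c')) := by
  obtain ⟨h0, h1, h2, h3⟩ := pauli_fierz a b c d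
  obtain ⟨k0, k1, k2, k3⟩ := pauli_fierz a' b' c' d'
  simp only [mul_mul_mul_comm _ (star _), ← star_mul', Fin.sum_univ_four, h0, h1, h2, h3,
    k0, k1, k2, k3]
  simp only [star_mul', star_add, star_sub, star_div₀, star_one, star_ofNat]
  ring

/-- The Smolin state is symmetric under the exchange of the first two senders. -/
theorem smolin_apply_swap (p q : Senders 2 2 2 × Fin 2) :
    smolin p q = 1 / 4 * ∑ μ, bellProj μ (p.1.2.1, p.2) (q.1.2.1, q.2) *
      bellProj μ (p.1.1, p.1.2.2) (q.1.1, q.1.2.2) := by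
  have h := sum_pauli_swap p.1.1 p.1.2.1 p.1.2.2 p.2 q.1.1 q.1.2.1 q.1.2.2 q.2
  rw [smolin_apply]
  simp only [bellProj_apply, mul_mul_mul_comm (1 / 2 : ℂ), ← Finset.mul_sum, h]

theorem quarter_sum_mem_separable {X : Op ((Fin 2 × Fin 2) × (Fin 2 × Fin 2))}
    (hX : ∀ p q, X p q = 1 / 4 * ∑ μ, bellProj μ p.1 q.1 * bellProj μ p.2 q.2) :
    X ∈ separable (Fin 2 × Fin 2) (Fin 2 × Fin 2) := by
  have : X = ∑ μ, ((1 / 4 : ℂ) • bellProj μ) ⊗ₖ bellProj μ := by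
    ext p q
    simp [hX, Matrix.sum_apply, Finset.mul_sum, mul_assoc]
  rw [this]
  refine AddSubmonoid.sum_mem _ fun μ _ => kronecker_mem_separable ?_ (bellProj_posSemidef μ)
  refine (bellProj_posSemidef μ).smul ?_
  rw [one_div]
  exact inv_nonneg.mpr (by norm_num)

theorem smolin_mem_separable₁ : smolin ∈ separable₁ 2 2 2 2 :=
  quarter_sum_mem_separable fun p q => smolin_apply (cut₁ _ _ _ _ p) (cut₁ _ _ _ _ q)

theorem smolin_mem_separable₂ : smolin ∈ separable₂ 2 2 2 2 :=
  quarter_sum_mem_separable fun p q => smolin_apply_swap (cut₂ _ _ _ _ p) (cut₂ _ _ _ _ q)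

theorem traceFst_smolin : traceFst smolin = ((1 / 2 : ℝ) : ℂ) • (1 : Op (Fin 2)) := by
  ext k l
  have : traceFst smolin k l = 1 / 4 * ∑ μ, (traceFst (bellProj μ) k l * (bellProj μ).trace) := by
    simp only [traceFst, of_apply, smolin_apply, Matrix.trace, diag_apply, ← Finset.mul_sum]
    rw [Finset.sum_comm]
    congr 1
    refine Finset.sum_congr rfl fun μ _ => ?_
    rw [Finset.sum_mul_sum, Fintype.sum_prod_type]
  rw [this]
  simp only [traceFst, Matrix.trace, diag_apply, of_apply, bellProj_apply, Fintype.sum_prod_type,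
    Fin.sum_univ_four, Fin.sum_univ_two]
  fin_cases k <;> fin_cases l <;> simp [pauli] <;> norm_num

theorem entropy_traceFst_smolin : entropy (traceFst smolin) = 1 := by
  have : Real.log 2 ≠ 0 := (Real.log_pos one_lt_two).ne'
  rw [traceFst_smolin, entropy_smul_one, Real.negMulLog, one_div, Real.log_inv,
    Fintype.card_fin]
  push_cast
  field_simp

/-! ### Discarding a system -/

/-- The trace, as an operation with one-dimensional output. -/
def discard (n : ℕ) : Op (Fin n) →ₗ[ℂ] Op (Fin 1) where
  toFun X := Matrix.of fun _ _ => X.trace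
  map_add' X Y := by ext; simp [Matrix.trace_add]
  map_smul' c X := by ext; simp [Matrix.trace_smul]

theorem discard_isInstrument (n : ℕ) :
    IsInstrument (d := fun _ : Fin 1 => 1) fun _ : Fin 1 => discard n where
  cp _ k X hX := (traceFst_posSemidef hX).submatrix Prod.snd
  tp X := by simp [discard, Matrix.trace]

theorem exists_isLOCC_discard (a₁ a₂ a₃ : ℕ) :
    ∃ Λ : Op (Senders a₁ a₂ a₃) →ₗ[ℂ] Op (Senders 1 1 1), IsLOCC Λ :=
  ⟨_, .step₁ _ _ (discard_isInstrument a₁) fun _ =>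
    .step₂ _ _ (discard_isInstrument a₂) fun _ =>
    .step₃ _ _ (discard_isInstrument a₃) fun _ => .refl⟩

/-- With one-dimensional outputs, trace preservation alone determines the result: the receiver's
reduced state. -/
theorem entropy_onFst_discard {a₁ a₂ a₃ b : ℕ}
    {Λ : Op (Senders a₁ a₂ a₃) →ₗ[ℂ] Op (Senders 1 1 1)} (hΛ : IsLOCC Λ)
    {X : Op (Senders a₁ a₂ a₃ × Fin b)} (hX : X.PosSemidef) :
    entropy (onFst (Fin b) Λ X) = entropy (traceFst X) := by
  let e : Senders 1 1 1 × Fin b ≃ Fin b :=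
    ⟨Prod.snd, fun k => (0, k), fun _ => Prod.ext (Subsingleton.elim _ _) rfl, fun _ => rfl⟩
  have h : onFst (Fin b) Λ X = (traceFst X).submatrix e e := by
    ext p q
    obtain ⟨p, k⟩ := p
    obtain ⟨q, l⟩ := q
    rw [← traceFst_onFst hΛ.trace_eq]
    rw [Subsingleton.elim p 0, Subsingleton.elim q 0]
    simp [e, traceFst, Fintype.sum_prod_type]
    rfl
  rw [h, entropy_submatrix _ (traceFst_posSemidef hX).1]

theorem smolin_posSemidef : smolin.PosSemidef :=
  (Matrix.posSemidef_submatrix_equiv (cut₁ _ _ _ _)).mp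
    (separable.posSemidef (m := Fin 2 × Fin 2) (n := Fin 2 × Fin 2) smolin_mem_separable₁)

/-! ### Distilling a Bell state with global operations -/

/-- The Kraus operators `σ_μ ⊗ ⟨ψ_μ|`: measure `A₂A₃` in the Bell basis and correct `A₁`. -/
def distillKraus (μ : Fin 4) : Matrix (Senders 2 1 1) (Senders 2 2 2) ℂ :=
  Matrix.of fun p q => pauli μ p.1 q.1 * star (bell μ (q.2.1, q.2.2))

/-- The linear map `X ↦ ∑ μ, K μ * X * (K μ)ᴴ`. -/
def krausMap {m n : Type} {ι : Type*} [Fintype ι] [Fintype m] (K : ι → Matrix n m ℂ) :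
    Op m →ₗ[ℂ] Op n where
  toFun X := ∑ μ, K μ * X * (K μ)ᴴ
  map_add' X Y := by simp [Matrix.mul_add, Matrix.add_mul, Finset.sum_add_distrib]
  map_smul' c X := by simp [Finset.smul_sum]

theorem onFst_krausMap {m n r : Type} {ι : Type*} [Fintype ι] [Fintype m] [Fintype r]
    [DecidableEq r] (K : ι → Matrix n m ℂ) (X : Op (m × r)) :
    onFst r (krausMap K) X
      = ∑ μ, (K μ ⊗ₖ (1 : Op r)) * X * (K μ ⊗ₖ (1 : Op r))ᴴ := by
  ext p q
  change (∑ μ, K μ * (Matrix.of fun s t => X (s, p.2) (t, q.2)) * (K μ)ᴴ) p.1 q.1 = _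
  rw [Matrix.sum_apply, Matrix.sum_apply]
  refine Finset.sum_congr rfl fun μ _ => ?_
  rw [conjTranspose_kronecker]
  simp [mul_apply, Fintype.sum_prod_type, Matrix.one_apply]

theorem krausMap_isCPTP {m n : Type} {ι : Type*} [Fintype ι] [Fintype m] [Fintype n]
    [DecidableEq m] (K : ι → Matrix n m ℂ) (hK : ∑ μ, (K μ)ᴴ * K μ = 1) :
    IsCPTP (krausMap K) where
  cp k X hX := by
    rw [onFst_krausMap]
    exact Matrix.posSemidef_sum _ fun μ _ => hX.mul_mul_conjTranspose_same _
  tp X := by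
    change (∑ μ, K μ * X * (K μ)ᴴ).trace = X.trace
    rw [Matrix.trace_sum]
    simp only [fun μ => Matrix.trace_mul_cycle (K μ) X (K μ)ᴴ]
    rw [← Matrix.trace_sum, ← Finset.sum_mul, hK, one_mul]

theorem pauli_conjTranspose_mul_self (μ : Fin 4) : (pauli μ)ᴴ * pauli μ = 1 := by
  ext i j
  fin_cases μ <;> fin_cases i <;> fin_cases j <;> simp [pauli, mul_apply]

theorem sum_bellProj : ∑ μ, bellProj μ = 1 := by
  ext ⟨a, b⟩ ⟨c, d⟩
  simp only [Matrix.sum_apply, bellProj_apply, Fin.sum_univ_four]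
  fin_cases a <;> fin_cases b <;> fin_cases c <;> fin_cases d <;> simp [pauli] <;> norm_num

/-- Unitarity of `σ_μ` leaves `1 ⊗ |ψ_μ⟩⟨ψ_μ|`, and the Bell projectors sum to the identity. -/
theorem sum_distillKraus : ∑ μ, (distillKraus μ)ᴴ * distillKraus μ = 1 := by
  have h : ∀ μ, (distillKraus μ)ᴴ * distillKraus μ = (1 : Op (Fin 2)) ⊗ₖ bellProj μ := by
    intro μ
    ext p q
    rw [← pauli_conjTranspose_mul_self μ]
    simp [distillKraus, mul_apply, Fintype.sum_prod_type, bellProj, vecMulVec_apply]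
    ring
  simp only [h]
  have : ∑ μ, (1 : Op (Fin 2)) ⊗ₖ bellProj μ = (1 : Op (Fin 2)) ⊗ₖ ∑ μ, bellProj μ := by
    ext p q
    simp [Matrix.sum_apply, Finset.mul_sum]
  rw [this, sum_bellProj, one_kronecker_one]

/-- The Smolin state as a mixture of products of Bell vectors. -/
def smolinVec (μ : Fin 4) : Senders 2 2 2 × Fin 2 → ℂ :=
  fun p => bell μ (p.1.1, p.2) * bell μ (p.1.2.1, p.1.2.2)

/-- The Bell state of `A₁` and `B`. -/
def bellVec : Senders 2 1 1 × Fin 2 → ℂ := fun p => bell 0 (p.1.1, p.2)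

theorem smolin_eq_sum :
    smolin = (1 / 4 : ℂ) • ∑ μ, vecMulVec (smolinVec μ) (star (smolinVec μ)) := by
  ext p q
  rw [smolin_apply]
  simp [Matrix.sum_apply, vecMulVec_apply, smolinVec, bellProj, mul_mul_mul_comm]

/-- Bell orthogonality excludes the outcomes `μ ≠ ν`; for `μ = ν` the correction works because `σ_μ²
= 1`. -/
theorem distillKraus_mulVec (μ ν : Fin 4) :
    (distillKraus μ ⊗ₖ (1 : Op (Fin 2))) *ᵥ smolinVec ν = if μ = ν then bellVec else 0 := by
  ext ⟨⟨a, b, c⟩, k⟩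
  have h : ((distillKraus μ ⊗ₖ (1 : Op (Fin 2))) *ᵥ smolinVec ν) ((a, b, c), k)
      = (∑ s, pauli μ a s * bell ν (s, k)) * ∑ p, star (bell μ p) * bell ν p := by
    simp only [mulVec, dotProduct, kroneckerMap_apply, Fintype.sum_prod_type, Matrix.one_apply,
      distillKraus, of_apply, smolinVec, mul_ite, mul_one, mul_zero, ite_mul, zero_mul,
      Finset.sum_ite_eq, Finset.mem_univ, if_true, Finset.sum_mul_sum]
    refine Finset.sum_congr rfl fun _ _ => Finset.sum_congr rfl fun _ _ => ?_
    rw [Finset.mul_sum]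
    exact Finset.sum_congr rfl fun _ _ => by ring
  have h2 : ∑ p, star (bell μ p) * bell ν p = if μ = ν then 1 else 0 := by
    have : ∀ p, star (bell μ p) * bell ν p
        = 1 / 2 * (star (pauli μ p.1 p.2) * pauli ν p.1 p.2) := fun p => by
      rw [← inv_sqrt_two_mul_self, bell_apply, bell_apply, star_mul',
        star_inv_sqrt_two]
      ring
    simp only [this, Fintype.sum_prod_type, Fin.sum_univ_two]
    fin_cases μ <;> fin_cases ν <;> simp [pauli] <;> norm_num
  rw [h, h2]
  by_cases hμν : μ = ν
  · subst hμν
    simp only [if_true, mul_one, bellVec, bell_apply]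
    fin_cases μ <;> fin_cases a <;> fin_cases k <;> simp [pauli]
    all_goals rw [← mul_assoc, Complex.I_mul_I]; simp
  · simp [hμν]

theorem onFst_distill_smolin :
    onFst (Fin 2) (krausMap distillKraus) smolin = vecMulVec bellVec (star bellVec) := by
  have h : ∀ μ ν, (distillKraus μ ⊗ₖ (1 : Op (Fin 2))) *
      vecMulVec (smolinVec ν) (star (smolinVec ν)) * (distillKraus μ ⊗ₖ (1 : Op (Fin 2)))ᴴ
      = if μ = ν then vecMulVec bellVec (star bellVec) else 0 := by
    intro μ ν
    rw [mul_vecMulVec, vecMulVec_mul, ← star_mulVec, distillKraus_mulVec]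
    split_ifs <;> simp
  rw [onFst_krausMap, smolin_eq_sum]
  simp only [Matrix.mul_smul, Matrix.smul_mul, Matrix.mul_sum, Matrix.sum_mul, h]
  simp only [Finset.sum_ite_eq, Finset.mem_univ, if_true, Finset.sum_const, Finset.card_univ,
    Fintype.card_fin, ← Nat.cast_smul_eq_nsmul ℂ, smul_smul]
  norm_num

theorem entropy_distill_smolin :
    entropy (onFst (Fin 2) (krausMap distillKraus) smolin) = 0 := by
  rw [onFst_distill_smolin]
  have h1 : star bellVec ⬝ᵥ bellVec = 1 := by
    simp [dotProduct, bellVec, Fintype.sum_prod_type, bell_apply, pauli, Fin.sum_univ_two]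
    rw [inv_sqrt_two_mul_self]
    norm_num
  refine entropy_of_isIdempotent (posSemidef_vecMulVec_self_star _).1 ?_
  rw [vecMulVec_mul_vecMulVec, h1]
  simp

end DenseCoding

end

theorem mainTheorem3 :
    advantageLOCC smolin = 0 ∧
    0 < advantageG smolin ∧
    ∀ (b₁ b₂ b₃ : ℕ)
      (Λ : Op (Senders 2 2 2) →ₗ[ℂ]
        Op (Senders b₁ b₂ b₃)),
      IsLOCC Λ →
        entropy (reduceA₁B
            (onFst (Fin 2) Λ smolin)) ≤
          entropy (onFst (Fin 2) Λ smolin) ∧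
        entropy (traceFst smolin) ≤
          entropy (reduceA₁B
            (onFst (Fin 2) Λ smolin)) := by
  have main : ∀ (b₁ b₂ b₃ : ℕ) (Λ : Op (Senders 2 2 2) →ₗ[ℂ] Op (Senders b₁ b₂ b₃)), IsLOCC Λ →
      entropy (reduceA₁B (onFst (Fin 2) Λ smolin)) ≤ entropy (onFst (Fin 2) Λ smolin) ∧
        entropy (traceFst smolin) ≤ entropy (reduceA₁B (onFst (Fin 2) Λ smolin)) :=
    fun _ _ _ Λ hΛ => ⟨hΛ.entropy_reduceA₁B_le smolin_mem_separable₁,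
      hΛ.entropy_traceFst_le smolin_mem_separable₂⟩
  refine ⟨?_, ?_, main⟩
  · obtain ⟨Λ, hΛ⟩ := exists_isLOCC_discard 2 2 2
    have hinf : (⨅ (b₁ : ℕ) (b₂ : ℕ) (b₃ : ℕ)
        (Λ : Op (Senders 2 2 2) →ₗ[ℂ] Op (Senders b₁ b₂ b₃)) (_ : IsLOCC Λ),
        (entropy (onFst (Fin 2) Λ smolin) : EReal)) = entropy (traceFst smolin) := by
      refine le_antisymm ?_ ?_
      · refine (iInf_le_of_le 1 <| iInf_le_of_le 1 <| iInf_le_of_le 1 <| iInf_le_of_le Λ <|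
          iInf_le_of_le hΛ ?_)
        rw [entropy_onFst_discard hΛ smolin_posSemidef]
      · refine le_iInf fun b₁ => le_iInf fun b₂ => le_iInf fun b₃ => le_iInf fun Λ =>
          le_iInf fun hΛ => ?_
        obtain ⟨h1, h2⟩ := main b₁ b₂ b₃ Λ hΛ
        exact EReal.coe_le_coe_iff.mpr (h2.trans h1)
    rw [advantageLOCC, advantage, hinf]
    -- Finiteness matters: in `EReal` the difference `⊤ - ⊤` is not 0.
    exact EReal.sub_self (EReal.coe_ne_top _) (EReal.coe_ne_bot _)
  · have hinf : (⨅ (b₁ : ℕ) (b₂ : ℕ) (b₃ : ℕ)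
        (Λ : Op (Senders 2 2 2) →ₗ[ℂ] Op (Senders b₁ b₂ b₃)) (_ : IsCPTP Λ),
        (entropy (onFst (Fin 2) Λ smolin) : EReal)) ≤ 0 := by
      refine (iInf_le_of_le 2 <| iInf_le_of_le 1 <| iInf_le_of_le 1 <|
        iInf_le_of_le (krausMap distillKraus) <|
        iInf_le_of_le (krausMap_isCPTP _ sum_distillKraus) ?_)
      rw [entropy_distill_smolin, EReal.coe_zero]
    rw [advantageG, advantage, entropy_traceFst_smolin]
    -- An upper bound 0 on the infimum suffices: the advantage is at least `1 - 0`.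
    refine lt_of_lt_of_le ?_ (EReal.sub_le_sub le_rfl hinf)
    simp
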